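/- Let $\mathsf W,\mathsf X$ be standard Borel spaces, let $p,n\ge 0$ be integers and let $b>0$. Let $P_W$ be a probability measure on $\mathsf W$ and let $P_{Z|W}=P_{X,Y|W}$ be a Markov kernel from $\mathsf W$ to $\mathsf X\times\mathbb R^p$. Let the parameter $W$, the data $Z^n=(Z_1,\dots,Z_n)$ with $Z_i=(X_i,Y_i)$, and the fresh pair $Z=(X,Y)$ be random elements on a common probability space with joint law $$P_{W,Z^n,Z}=P_W\Big(\prod_{i=1}^n P_{Z_i|W}\Big)P_{Z|W},\qquad P_{Z_i|W}=P_{Z|W},$$ i.e. $Z_1,\dots,Z_n,Z$ are conditionally i.i.d. given $W$. Assume that $\|Y\|\le b$ almost surely, where $\|\cdot\|$ is the Euclidean norm. Let the action space $\mathsf A\subseteq\mathbb R^p$ be any set containing the closed ball $\{y:\|y\|\le b\}$ (for instance this ball, or $\mathbb R^p$). For a random element $V$ of a space $\mathsf V$, let $$R_2(Y|V)=\inf_{\psi}\ \mathbb E\big[\|Y-\psi(V)\|^2\big],$$ where the infimum is over all measurable $\psi:\mathsf V\to\mathsf A$, and define the minimum excess risk for the quadratic loss by $$\mathrm{MER}_2=R_2(Y|X,Z^n)-R_2(Y|X,W).$$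 Then $$\mathrm{MER}_2\le 2b^2\, I(W;Y|X,Z^n),$$ where $$I(W;Y|X,Z^n)=\int D_{\mathrm{KL}}\big(P_{W,Y|X=x,Z^n=z^n}\,\big\|\,P_{W|X=x,Z^n=z^n}\otimes P_{Y|X=x,Z^n=z^n}\big)\,P_{X,Z^n}(\mathrm dx,\mathrm dz^n)\in[0,\infty]$$ is the conditional mutual information, computed with natural logarithms. -/

import Mathlib

open MeasureTheory ProbabilityTheory InformationTheory
open scoped ENNReal

namespace BayesianLearning

/-- For a Markov kernel `κ`, the map `w ↦ κ(w)^{⊗ n}` is measurable. -/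
lemma measurable_pi_kernel {𝒲 𝒵 : Type*} [MeasurableSpace 𝒲] [MeasurableSpace 𝒵]
    (κ : Kernel 𝒲 𝒵) [IsMarkovKernel κ] (n : ℕ) :
    Measurable (fun w => Measure.pi (fun _ : Fin n => κ w)) := by
  refine Measurable.measure_of_isPiSystem_of_isProbabilityMeasure
    generateFrom_pi.symm isPiSystem_pi ?_
  rintro _ ⟨s, hs, rfl⟩
  simp only [Measure.pi_pi]
  exact Finset.measurable_prod _ fun i _ => κ.measurable_coe (hs i (Set.mem_univ i))

/-- The kernel `w ↦ P_{Z|W=w}^{⊗ n}`: the conditional law of `n` samples that are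
conditionally i.i.d. given the model parameter. -/
noncomputable def iidKernel {𝒲 𝒵 : Type*} [MeasurableSpace 𝒲] [MeasurableSpace 𝒵]
    (κ : Kernel 𝒲 𝒵) [IsMarkovKernel κ] (n : ℕ) : Kernel 𝒲 (Fin n → 𝒵) where
  toFun w := Measure.pi (fun _ : Fin n => κ w)
  measurable' := measurable_pi_kernel κ n

instance {𝒲 𝒵 : Type*} [MeasurableSpace 𝒲] [MeasurableSpace 𝒵]
    (κ : Kernel 𝒲 𝒵) [IsMarkovKernel κ] (n : ℕ) : IsMarkovKernel (iidKernel κ n) :=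
  ⟨fun w => inferInstanceAs (IsProbabilityMeasure (Measure.pi (fun _ : Fin n => κ w)))⟩

/-- The Bayesian generative model with prior `prior = P_W` and model family `κ = P_{X,Y|W}`:
the parameter `W`, the data set `data = (Z_1, …, Z_n)`, `Z_i = (X_i, Y_i)`, and the fresh pair
`Z = (X, Y)` have joint law `P_W (∏ P_{Z_i|W}) P_{Z|W}`. -/
structure IsGenerativeModel {Ω 𝒲 𝒳 𝒴 : Type*} [MeasurableSpace Ω] [MeasurableSpace 𝒲]
    [MeasurableSpace 𝒳] [MeasurableSpace 𝒴] {n : ℕ} (P : Measure Ω)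
    (prior : Measure 𝒲) (κ : Kernel 𝒲 (𝒳 × 𝒴)) [IsMarkovKernel κ]
    (W : Ω → 𝒲) (data : Ω → Fin n → 𝒳 × 𝒴) (X : Ω → 𝒳) (Y : Ω → 𝒴) : Prop where
  measurable_param : Measurable W
  measurable_data : Measurable data
  measurable_obs : Measurable X
  measurable_target : Measurable Y
  law : P.map (fun ω => (W ω, data ω, X ω, Y ω)) = prior ⊗ₘ (iidKernel κ n ×ₖ κ)

/-- The expectation of `f` is defined (possibly as `±∞`): its positive and negative parts
do not both have infinite integral. -/
def ExpectationDefined {Ω : Type*} [MeasurableSpace Ω] (P : Measure Ω) (f : Ω → ℝ) : Prop :=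
  (∫⁻ ω, ENNReal.ofReal (f ω) ∂P) ≠ ∞ ∨ (∫⁻ ω, ENNReal.ofReal (-f ω) ∂P) ≠ ∞

/-- The expectation `𝔼[f] = 𝔼[f⁺] - 𝔼[f⁻]` in the extended reals. -/
noncomputable def expectation {Ω : Type*} [MeasurableSpace Ω] (P : Measure Ω) (f : Ω → ℝ) :
    EReal :=
  ((∫⁻ ω, ENNReal.ofReal (f ω) ∂P : ℝ≥0∞) : EReal)
    - ((∫⁻ ω, ENNReal.ofReal (-f ω) ∂P : ℝ≥0∞) : EReal)

/-- The Bayes risk `R_ℓ(Y|V)`: the infimum of `𝔼[ℓ(Y, ψ(V))]` over all (measurable) decision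
rules `ψ : 𝒱 → 𝒜` for which this expectation is defined. -/
noncomputable def bayesRisk {Ω 𝒴 𝒱 𝒜 : Type*} [MeasurableSpace Ω] [MeasurableSpace 𝒱]
    [MeasurableSpace 𝒜] (P : Measure Ω) (ℓ : 𝒴 → 𝒜 → ℝ) (Y : Ω → 𝒴) (V : Ω → 𝒱) : EReal :=
  ⨅ ψ : {ψ : 𝒱 → 𝒜 // Measurable ψ ∧ ExpectationDefined P (fun ω => ℓ (Y ω) (ψ (V ω)))},
    expectation P (fun ω => ℓ (Y ω) (ψ.1 (V ω)))

/-- The minimum excess risk `MER_ℓ = R_ℓ(Y|X,Zⁿ) - R_ℓ(Y|X,W)`. -/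
noncomputable def minimumExcessRisk {Ω 𝒲 𝒳 𝒴 𝒜 : Type*} [MeasurableSpace Ω]
    [MeasurableSpace 𝒲] [MeasurableSpace 𝒳] [MeasurableSpace 𝒴] [MeasurableSpace 𝒜] {n : ℕ}
    (P : Measure Ω) (ℓ : 𝒴 → 𝒜 → ℝ)
    (W : Ω → 𝒲) (data : Ω → Fin n → 𝒳 × 𝒴) (X : Ω → 𝒳) (Y : Ω → 𝒴) : EReal :=
  bayesRisk P ℓ Y (fun ω => (X ω, data ω)) - bayesRisk P ℓ Y (fun ω => (X ω, W ω))

/-- The quadratic loss `ℓ(y, a) = ‖y - a‖²` on `ℝ^p`, with actions in a set `𝒜 ⊆ ℝ^p`. -/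
noncomputable def quadraticLoss {p : ℕ} (𝒜 : Set (EuclideanSpace ℝ (Fin p)))
    (y : EuclideanSpace ℝ (Fin p)) (a : 𝒜) : ℝ :=
  ‖y - (a : EuclideanSpace ℝ (Fin p))‖ ^ 2

/-- The conditional mutual information (in nats)
`I(U;V|T) = ∫ D_KL(P_{U,V|T=t} ‖ P_{U|T=t} ⊗ P_{V|T=t}) P_T(dt)`, with values in `[0, ∞]`. -/
noncomputable def condMutualInfo {Ω 𝒰 𝒱 𝒯 : Type*} [MeasurableSpace Ω]
    [MeasurableSpace 𝒰] [StandardBorelSpace 𝒰] [Nonempty 𝒰]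
    [MeasurableSpace 𝒱] [StandardBorelSpace 𝒱] [Nonempty 𝒱] [MeasurableSpace 𝒯]
    (P : Measure Ω) [IsFiniteMeasure P] (U : Ω → 𝒰) (V : Ω → 𝒱) (T : Ω → 𝒯) : ℝ≥0∞ :=
  ∫⁻ t, klDiv (condDistrib (fun ω => (U ω, V ω)) T P t)
    ((condDistrib U T P t).prod (condDistrib V T P t)) ∂(P.map T)

end BayesianLearning

/-! Write `T = (X, Zⁿ)` and let `m(T)` be the conditional mean of `Y`. For a competitor `ψ(T, W)`
put `f = (‖Y - m‖² - ‖Y - ψ‖²) / (2b²)`. With `W` and `Y` conditionally independent given `T`,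
Hoeffding's lemma gives `𝔼 exp f ≤ 1` (`lintegral_exp_excess_quadratic_le_one`). Donsker–Varadhan
(`ofReal_integral_le_klDiv`) then bounds the mean of `f` under the true conditional law by the
divergence from that product law. Averaging over `T` yields `2b² I(W;Y|T)`. -/

lemma ofReal_integral_le_lintegral_ofReal {α : Type*} [MeasurableSpace α] {μ : Measure α}
    (f : α → ℝ) : ENNReal.ofReal (∫ x, f x ∂μ) ≤ ∫⁻ x, ENNReal.ofReal (f x) ∂μ := by
  by_cases hf : Integrable f μ
  · calc ENNReal.ofReal (∫ x, f x ∂μ) ≤ ENNReal.ofReal (∫ x, max (f x) 0 ∂μ) :=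
          ENNReal.ofReal_le_ofReal (integral_mono hf hf.pos_part fun x => le_max_left _ _)
      _ = ∫⁻ x, ENNReal.ofReal (max (f x) 0) ∂μ :=
          ofReal_integral_eq_lintegral_ofReal hf.pos_part (.of_forall fun _ => le_max_right _ _)
      _ = ∫⁻ x, ENNReal.ofReal (f x) ∂μ := by simp [ENNReal.ofReal_max]
  -- The Bochner integral defaults to `0` here.
  · simp [integral_undef hf]

open Real in
/-- One half of the Donsker–Varadhan variational formula. -/
lemma ofReal_integral_le_klDiv {α : Type*} [MeasurableSpace α] (μ ν : Measure α)
    [IsProbabilityMeasure μ] [IsProbabilityMeasure ν] {f : α → ℝ} (hf : Measurable f)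
    (hfμ : Integrable f μ) (hfν : ∫⁻ x, ENNReal.ofReal (exp (f x)) ∂ν ≤ 1) :
    ENNReal.ofReal (∫ x, f x ∂μ) ≤ klDiv μ ν := by
  by_cases h_top : klDiv μ ν = ∞
  · simp [h_top]
  obtain ⟨hac, hllr⟩ := klDiv_ne_top_iff.mp h_top
  rw [klDiv_of_ac_of_integrable hac hllr]
  refine ENNReal.ofReal_le_ofReal ?_
  -- Change of measure: `exp (-llr μ ν)` is the density of the `μ`-continuous part of `ν`, hence
  -- only `≤`.
  have hexp : ∫⁻ x, ENNReal.ofReal (exp (f x - llr μ ν x)) ∂μ ≤ 1 := by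
    calc ∫⁻ x, ENNReal.ofReal (exp (f x - llr μ ν x)) ∂μ
        = ∫⁻ x, ν.rnDeriv μ x * ENNReal.ofReal (exp (f x)) ∂μ := by
          refine lintegral_congr_ae ?_
          filter_upwards [exp_neg_llr hac, ν.rnDeriv_lt_top μ] with x hx hlt
          rw [sub_eq_add_neg, exp_add, hx, mul_comm, ENNReal.ofReal_mul ENNReal.toReal_nonneg,
            ENNReal.ofReal_toReal hlt.ne]
      _ = ∫⁻ x, ENNReal.ofReal (exp (f x)) ∂(μ.withDensity (ν.rnDeriv μ)) := by
          rw [lintegral_withDensity_eq_lintegral_mul _ (ν.measurable_rnDeriv μ) (by fun_prop)]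
          rfl
      _ ≤ ∫⁻ x, ENNReal.ofReal (exp (f x)) ∂ν :=
          lintegral_mono' (ν.withDensity_rnDeriv_le μ) le_rfl
      _ ≤ 1 := hfν
  have hint : Integrable (fun x => exp (f x - llr μ ν x)) μ :=
    (lintegral_ofReal_ne_top_iff_integrable (by fun_prop)
      (.of_forall fun _ => (exp_pos _).le)).mp (hexp.trans_lt ENNReal.one_lt_top).ne
  have hle : ∫ x, exp (f x - llr μ ν x) ∂μ ≤ 1 := by
    rw [integral_eq_lintegral_of_nonneg_ae (.of_forall fun _ => (exp_pos _).le) (by fun_prop)]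
    exact ENNReal.toReal_le_of_le_ofReal zero_le_one (by simpa using hexp)
  -- The bound `t + 1 ≤ exp t` takes the place of Jensen's inequality.
  have hmono : ∫ x, (f x - llr μ ν x + 1) ∂μ ≤ ∫ x, exp (f x - llr μ ν x) ∂μ :=
    integral_mono ((hfμ.sub hllr).add (integrable_const 1)) hint fun x => add_one_le_exp _
  have hadd : ∫ x, (f x - llr μ ν x + 1) ∂μ = ∫ x, (f x - llr μ ν x) ∂μ + ∫ _, (1 : ℝ) ∂μ :=
    integral_add (hfμ.sub hllr) (integrable_const 1)
  rw [hadd, integral_sub hfμ hllr] at hmono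
  simp only [integral_const, probReal_univ, smul_eq_mul, mul_one] at hmono ⊢
  linarith

section QuadraticLoss

variable {E : Type*} [NormedAddCommGroup E] [InnerProductSpace ℝ E] [FiniteDimensional ℝ E]
  [MeasurableSpace E] [BorelSpace E]

/-- Hoeffding's lemma for the excess quadratic loss of the mean over an arbitrary action. -/
lemma lintegral_exp_excess_quadratic_le_one (ν : Measure E) [IsProbabilityMeasure ν] {b : ℝ}
    (hb : 0 < b) (hν : ∀ᵐ y ∂ν, ‖y‖ ≤ b) (a : E) :
    ∫⁻ y, ENNReal.ofReal
      (Real.exp ((‖y - ∫ z, z ∂ν‖ ^ 2 - ‖y - a‖ ^ 2) / (2 * b ^ 2))) ∂ν ≤ 1 := by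
  set m := ∫ z, z ∂ν
  set δ := a - m with hδ
  have hint : Integrable (fun y : E => y) ν :=
    Integrable.of_bound (by fun_prop) b hν
  have hmean : ∫ y, inner ℝ δ y ∂ν = inner ℝ δ m := integral_inner hint δ
  have hsub := hasSubgaussianMGF_of_mem_Icc (μ := ν) (X := fun y => inner ℝ δ y)
    (a := -(‖δ‖ * b)) (b := ‖δ‖ * b) (by fun_prop) (by
      filter_upwards [hν] with y hy
      exact abs_le.mp ((abs_real_inner_le_norm δ y).trans (by gcongr)))
  rw [hmean] at hsub
  have hnn : 0 ≤ ‖δ‖ * b := by positivity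
  have hc : (((‖‖δ‖ * b - -(‖δ‖ * b)‖₊ / 2) ^ 2 : NNReal) : ℝ) = (‖δ‖ * b) ^ 2 := by
    push_cast
    rw [Real.norm_of_nonneg (by linarith)]
    ring
  -- The excess loss is `2⟪δ, y - m⟫ - ‖δ‖²`; after division by `2b²` its linear part has
  -- coefficient `1 / b²`. With variance proxy `(‖δ‖b)²`, the resulting factor `exp (‖δ‖² / (2b²))`
  -- exactly cancels the quadratic term.
  have hmgf := hsub.mgf_le (1 / b ^ 2)
  have hintexp := hsub.integrable_exp_mul (1 / b ^ 2)
  rw [hc, mgf] at hmgf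
  have hfun : ∀ y, Real.exp ((‖y - m‖ ^ 2 - ‖y - a‖ ^ 2) / (2 * b ^ 2))
      = Real.exp (-(‖δ‖ ^ 2 / (2 * b ^ 2)))
        * Real.exp (1 / b ^ 2 * (inner ℝ δ y - inner ℝ δ m)) := by
    intro y
    rw [← Real.exp_add]
    congr 1
    have h1 : y - a = (y - m) - δ := by rw [hδ]; abel
    rw [h1, norm_sub_sq_real (y - m) δ, ← inner_sub_right, real_inner_comm δ (y - m)]
    field_simp
    ring
  simp_rw [hfun]
  rw [← ofReal_integral_eq_lintegral_ofReal (hintexp.const_mul _)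
    (.of_forall fun _ => by positivity), integral_const_mul]
  refine ENNReal.ofReal_le_one.mpr ?_
  calc _ ≤ Real.exp (-(‖δ‖ ^ 2 / (2 * b ^ 2)))
        * Real.exp ((‖δ‖ * b) ^ 2 * (1 / b ^ 2) ^ 2 / 2) := by gcongr
    _ = 1 := by
      rw [← Real.exp_add, Real.exp_eq_one_iff]
      field_simp
      ring

/-- The conditional mean `t ↦ 𝔼[Y|T=t]`, replaced by `0` where it leaves the ball of radius `b`. -/
noncomputable def truncatedCondMean {Ω 𝒯 : Type*} [MeasurableSpace Ω] [MeasurableSpace 𝒯]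
    (P : Measure Ω) [IsFiniteMeasure P] (Y : Ω → E) (T : Ω → 𝒯) (b : ℝ) : 𝒯 → E :=
  {t | ‖∫ y, y ∂condDistrib Y T P t‖ ≤ b}.indicator fun t => ∫ y, y ∂condDistrib Y T P t

variable {Ω 𝒯 : Type*} [MeasurableSpace Ω] [MeasurableSpace 𝒯]
  (P : Measure Ω) [IsProbabilityMeasure P] {Y : Ω → E} {T : Ω → 𝒯} {b : ℝ}

lemma norm_truncatedCondMean_le (hb : 0 < b) (t : 𝒯) : ‖truncatedCondMean P Y T b t‖ ≤ b := by
  rw [truncatedCondMean, Set.indicator_apply]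
  split_ifs with h
  · exact h
  · simpa using hb.le

lemma measurable_truncatedCondMean : Measurable (truncatedCondMean P Y T b) := by
  have h : Measurable fun t => ∫ y, y ∂condDistrib Y T P t :=
    (StronglyMeasurable.integral_condDistrib (f := fun q : 𝒯 × E => q.2)
      measurable_snd.stronglyMeasurable).measurable
  exact h.indicator (measurableSet_le h.norm measurable_const)

variable {P}

lemma ae_condDistrib_norm_le (hT : Measurable T) (hYm : Measurable Y)
    (hY : ∀ᵐ ω ∂P, ‖Y ω‖ ≤ b) :
    ∀ᵐ t ∂(P.map T), ∀ᵐ y ∂condDistrib Y T P t, ‖y‖ ≤ b := by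
  have h : ∀ᵐ q ∂(P.map T ⊗ₘ condDistrib Y T P), ‖q.2‖ ≤ b := by
    rw [compProd_map_condDistrib hYm.aemeasurable,
      ae_map_iff (by fun_prop) (measurableSet_le (by fun_prop) measurable_const)]
    exact hY
  exact Measure.ae_ae_of_ae_compProd h

/-- The truncation acts only on a null set; its purpose is a rule landing in the ball, hence in `𝒜`,
at every point. -/
lemma truncatedCondMean_ae_eq (hT : Measurable T) (hYm : Measurable Y)
    (hY : ∀ᵐ ω ∂P, ‖Y ω‖ ≤ b) :
    ∀ᵐ t ∂(P.map T), truncatedCondMean P Y T b t = ∫ y, y ∂condDistrib Y T P t := by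
  filter_upwards [ae_condDistrib_norm_le hT hYm hY] with t ht
  refine Set.indicator_of_mem ?_ _
  simpa using norm_integral_le_of_norm_le_const ht

lemma integrable_norm_sub_truncatedCondMean_sq (hb : 0 < b) (hT : Measurable T)
    (hYm : Measurable Y) (hY : ∀ᵐ ω ∂P, ‖Y ω‖ ≤ b) :
    Integrable (fun ω => ‖Y ω - truncatedCondMean P Y T b (T ω)‖ ^ 2) P := by
  have hm := (measurable_truncatedCondMean P (Y := Y) (T := T) (b := b)).comp hT
  refine Integrable.of_bound (C := (b + b) ^ 2)
    ((hYm.sub hm).norm.pow_const 2).aestronglyMeasurable ?_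
  filter_upwards [hY] with ω hω
  rw [Real.norm_of_nonneg (by positivity)]
  gcongr
  exact (norm_sub_le _ _).trans (add_le_add hω (norm_truncatedCondMean_le P hb _))

/-- The quadratic risk of the conditional mean of `Y` given `T` exceeds the risk of any predictor
that may also use `U` by at most `2 b² I(U;Y|T)`. -/
lemma lintegral_truncatedCondMean_le_add_condMutualInfo {𝒰 : Type*} [MeasurableSpace 𝒰]
    [StandardBorelSpace 𝒰] [Nonempty 𝒰] {U : Ω → 𝒰} (hb : 0 < b)
    (hT : Measurable T) (hU : Measurable U) (hYm : Measurable Y) (hY : ∀ᵐ ω ∂P, ‖Y ω‖ ≤ b)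
    {ψ : 𝒯 × 𝒰 → E} (hψ : Measurable ψ) :
    ∫⁻ ω, ENNReal.ofReal (‖Y ω - truncatedCondMean P Y T b (T ω)‖ ^ 2) ∂P
      ≤ ∫⁻ ω, ENNReal.ofReal (‖Y ω - ψ (T ω, U ω)‖ ^ 2) ∂P
        + ENNReal.ofReal (2 * b ^ 2) * BayesianLearning.condMutualInfo P U Y T := by
  by_cases htop : ∫⁻ ω, ENNReal.ofReal (‖Y ω - ψ (T ω, U ω)‖ ^ 2) ∂P = ∞
  · rw [htop, top_add]
    exact le_top
  have hintψ : Integrable (fun ω => ‖Y ω - ψ (T ω, U ω)‖ ^ 2) P :=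
    (lintegral_ofReal_ne_top_iff_integrable
      ((hYm.sub (hψ.comp (hT.prodMk hU))).norm.pow_const 2).aestronglyMeasurable
      (.of_forall fun _ => by positivity)).mp htop
  have hintm := integrable_norm_sub_truncatedCondMean_sq hb hT hYm hY
  have hmm := measurable_truncatedCondMean P (Y := Y) (T := T) (b := b)
  set m := truncatedCondMean P Y T b
  let f : 𝒯 × 𝒰 × E → ℝ := fun q =>
    (‖q.2.2 - m q.1‖ ^ 2 - ‖q.2.2 - ψ (q.1, q.2.1)‖ ^ 2) / (2 * b ^ 2)
  have hf : Measurable f := by fun_prop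
  have hTUY : Measurable fun ω => (T ω, U ω, Y ω) := by fun_prop
  have hfP : Integrable (fun ω => f (T ω, U ω, Y ω)) P := (hintm.sub hintψ).div_const _
  have hfint : Integrable f (P.map fun ω => (T ω, U ω, Y ω)) :=
    (integrable_map_measure hf.aestronglyMeasurable hTUY.aemeasurable).mpr hfP
  have hUY : AEMeasurable (fun ω => (U ω, Y ω)) P := by fun_prop
  have hkl : ∀ᵐ t ∂(P.map T),
      ENNReal.ofReal (∫ q, f (t, q) ∂condDistrib (fun ω => (U ω, Y ω)) T P t)
        ≤ klDiv (condDistrib (fun ω => (U ω, Y ω)) T P t)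
          ((condDistrib U T P t).prod (condDistrib Y T P t)) := by
    filter_upwards [hfint.condDistrib_ae_map hUY, ae_condDistrib_norm_le hT hYm hY,
      truncatedCondMean_ae_eq hT hYm hY] with t hft hYt hmt
    refine ofReal_integral_le_klDiv _ _ (by fun_prop) hft ?_
    -- With `u` fixed in the outer integral, `ψ (t, u)` is a constant action under the law of `Y`
    -- given `T = t`.
    rw [lintegral_prod _ (by fun_prop)]
    calc _ ≤ ∫⁻ _, 1 ∂(condDistrib U T P t) := by
          refine lintegral_mono fun u => ?_
          simp only [f, m, hmt]
          exact lintegral_exp_excess_quadratic_le_one _ hb hYt _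
      _ = 1 := by simp
  have hI : ENNReal.ofReal (∫ ω, f (T ω, U ω, Y ω) ∂P)
      ≤ BayesianLearning.condMutualInfo P U Y T := by
    rw [← integral_map hTUY.aemeasurable hf.aestronglyMeasurable,
      ← compProd_map_condDistrib hUY, Measure.integral_compProd
        (by rwa [compProd_map_condDistrib hUY])]
    calc _ ≤ ∫⁻ t, ENNReal.ofReal
          (∫ q, f (t, q) ∂condDistrib (fun ω => (U ω, Y ω)) T P t) ∂(P.map T) :=
          ofReal_integral_le_lintegral_ofReal _
      _ ≤ _ := lintegral_mono_ae hkl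
  have heq : ∫ ω, ‖Y ω - m (T ω)‖ ^ 2 ∂P
      = ∫ ω, ‖Y ω - ψ (T ω, U ω)‖ ^ 2 ∂P + 2 * b ^ 2 * ∫ ω, f (T ω, U ω, Y ω) ∂P := by
    simp only [f]
    rw [integral_div, integral_sub hintm hintψ]
    field_simp
    ring
  rw [← ofReal_integral_eq_lintegral_ofReal hintm (.of_forall fun _ => by positivity),
    ← ofReal_integral_eq_lintegral_ofReal hintψ (.of_forall fun _ => by positivity), heq]
  refine ENNReal.ofReal_add_le.trans ?_
  rw [ENNReal.ofReal_mul (by positivity)]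
  gcongr

end QuadraticLoss

lemma expectation_of_nonneg {Ω : Type*} [MeasurableSpace Ω] (P : Measure Ω) {f : Ω → ℝ}
    (hf : ∀ ω, 0 ≤ f ω) :
    BayesianLearning.expectation P f = ((∫⁻ ω, ENNReal.ofReal (f ω) ∂P : ℝ≥0∞) : EReal) := by
  have h : ∀ ω, ENNReal.ofReal (-f ω) = 0 := fun ω =>
    ENNReal.ofReal_of_nonpos (neg_nonpos.mpr (hf ω))
  simp [BayesianLearning.expectation, h]

lemma expectationDefined_of_nonneg {Ω : Type*} [MeasurableSpace Ω] (P : Measure Ω) {f : Ω → ℝ}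
    (hf : ∀ ω, 0 ≤ f ω) : BayesianLearning.ExpectationDefined P f := by
  have h : ∀ ω, ENNReal.ofReal (-f ω) = 0 := fun ω =>
    ENNReal.ofReal_of_nonpos (neg_nonpos.mpr (hf ω))
  exact Or.inr (by simp [h])

theorem mainTheorem8 {Ω 𝒲 𝒳 : Type*} [MeasurableSpace Ω]
    [MeasurableSpace 𝒲] [StandardBorelSpace 𝒲] [Nonempty 𝒲]
    [MeasurableSpace 𝒳] [StandardBorelSpace 𝒳]
    (n p : ℕ) (b : ℝ) (hb : 0 < b)
    (P : Measure Ω) [IsProbabilityMeasure P]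
    (prior : Measure 𝒲) [IsProbabilityMeasure prior]
    (κ : Kernel 𝒲 (𝒳 × EuclideanSpace ℝ (Fin p))) [IsMarkovKernel κ]
    (W : Ω → 𝒲) (data : Ω → Fin n → 𝒳 × EuclideanSpace ℝ (Fin p))
    (X : Ω → 𝒳) (Y : Ω → EuclideanSpace ℝ (Fin p))
    (hmodel : BayesianLearning.IsGenerativeModel P prior κ W data X Y)
    (hY : ∀ᵐ ω ∂P, ‖Y ω‖ ≤ b)
    (𝒜 : Set (EuclideanSpace ℝ (Fin p))) (h𝒜 : Metric.closedBall 0 b ⊆ 𝒜) :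
    BayesianLearning.minimumExcessRisk P (BayesianLearning.quadraticLoss 𝒜) W data X Y
      ≤ ((2 * b ^ 2 : ℝ) : EReal) *
        ((BayesianLearning.condMutualInfo P W Y (fun ω => (X ω, data ω)) : ℝ≥0∞) : EReal) := by
  have hX := hmodel.measurable_obs
  have hD := hmodel.measurable_data
  have hW := hmodel.measurable_param
  have hYm := hmodel.measurable_target
  have hT : Measurable fun ω => (X ω, data ω) := hX.prodMk hD
  have hnn : ∀ y (a : 𝒜), 0 ≤ BayesianLearning.quadraticLoss 𝒜 y a := fun y a => sq_nonneg _
  set T := fun ω => (X ω, data ω)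
  set I := BayesianLearning.condMutualInfo P W Y T
  let ψ₀ : 𝒳 × (Fin n → 𝒳 × EuclideanSpace ℝ (Fin p)) → 𝒜 := fun t =>
    ⟨truncatedCondMean P Y T b t,
      h𝒜 (mem_closedBall_zero_iff.mpr (norm_truncatedCondMean_le P hb t))⟩
  have hψ₀ : Measurable ψ₀ := (measurable_truncatedCondMean P).subtype_mk
  set A := ∫⁻ ω, ENNReal.ofReal (‖Y ω - truncatedCondMean P Y T b (T ω)‖ ^ 2) ∂P
  have hupper : BayesianLearning.bayesRisk P (BayesianLearning.quadraticLoss 𝒜) Y T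
      ≤ (A : EReal) := by
    refine (iInf_le _ ⟨ψ₀, hψ₀, expectationDefined_of_nonneg P fun ω => hnn _ _⟩).trans_eq ?_
    exact expectation_of_nonneg P fun ω => hnn _ _
  -- Subtraction in `ℝ≥0∞` truncates at `0`, so the case `I = ∞` is included.
  have hlower : ((A - ENNReal.ofReal (2 * b ^ 2) * I : ℝ≥0∞) : EReal)
      ≤ BayesianLearning.bayesRisk P (BayesianLearning.quadraticLoss 𝒜) Y
        (fun ω => (X ω, W ω)) := by
    refine le_iInf fun ψ => ?_
    rw [expectation_of_nonneg P fun ω => hnn _ _, EReal.coe_ennreal_le_coe_ennreal_iff]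
    refine tsub_le_iff_right.mpr ?_
    -- A rule in `(X, W)` is a rule in `(T, W)` that ignores the data.
    exact lintegral_truncatedCondMean_le_add_condMutualInfo
      (ψ := fun q => (ψ.1 (q.1.1, q.2) : EuclideanSpace ℝ (Fin p))) hb hT hW hYm hY
      (measurable_subtype_coe.comp (ψ.2.1.comp (by fun_prop)))
  have hcoe : ((2 * b ^ 2 : ℝ) : EReal) * ((I : ℝ≥0∞) : EReal)
      = ((ENNReal.ofReal (2 * b ^ 2) * I : ℝ≥0∞) : EReal) := by
    rw [EReal.coe_ennreal_mul, EReal.coe_ennreal_ofReal, max_eq_left (by positivity)]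
  rw [hcoe]
  refine EReal.sub_le_of_le_add' (hupper.trans ?_)
  refine le_trans ?_ (add_le_add_left hlower _)
  rw [← EReal.coe_ennreal_add, EReal.coe_ennreal_le_coe_ennreal_iff]
  exact le_tsub_add
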